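/- Let $\mathbb{F}$ be a field, let $\Xi\subset\mathbb{F}^2$ be finite, with vanishing ideal $\mathcal{I}(\Xi)\subset\mathbb{F}[x,y]$, and let $\mu=\#\Xi$. *Orders.* $x^{\alpha_1}y^{\alpha_2}\prec_{\mathrm{lex}}x^{\beta_1}y^{\beta_2}$ iff the leftmost nonzero entry of $\beta-\alpha$ is positive; $\prec_{\mathrm{invlex}}$: iff the rightmost nonzero entry of $\beta-\alpha$ is positive; $\prec_{\mathrm{grlex}}$ compares total degrees first and then uses $\prec_{\mathrm{lex}}$; $\prec_{\mathrm{grevlex}}$ compares total degrees first, and for equal degrees $\alpha\prec\beta$ iff the rightmost nonzero entry of $\beta-\alpha$ is negative. *Lower sets.* Let $l_0^x,\dots,l_\nu^x$ be the horizontal lines that meet $\Xi$, numbered so that the number $m_j+1$ of points of $\Xi$ on $l_j^x$ satisfies $m_0\ge\dots\ge m_\nu\ge 0$; put $S_x(\Xi)=\{(i,j):0\le j\le\nu,\ 0\le i\le m_j\}$. Likewise, let the vertical lines $l_0^y,\dots,l_\lambda^y$ that meet $\Xi$ contain $n_0+1\ge\dots\ge n_\lambda+1$ points of $\Xi$; put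 $S_y(\Xi)=\{(i,j):0\le i\le\lambda,\ 0\le j\le n_i\}$. *Quasi-tower sets.* A nonempty $\Xi$ is *generalized $x$-tower* if $m_0>m_1>\dots>m_\nu\ge0$ and $\Xi=\{(x_{ij},y_j):(i,j)\in S_x(\Xi)\}$ with $x_{ij}$ distinct for fixed $j$; it is *$x$-tower* if moreover such a labelling exists in which every $x_{ij}$ is the abscissa of a point of $\Xi$ on $l_0^x$ (the line $y=y_0$); it is *quasi-$x$-tower* if it is generalized $x$-tower but not $x$-tower. Symmetrically, $\Xi$ is *generalized $y$-tower* if $n_0>\dots>n_\lambda\ge0$ and $\Xi=\{(x_i,y_{ij}):(i,j)\in S_y(\Xi)\}$ with $y_{ij}$ distinct for fixed $i$; *$y$-tower* if moreover every $y_{ij}$ is, in some such labelling, the ordinate of a point of $\Xi$ on $l_0^y$ (the line $x=x_0$); and *quasi-$y$-tower* if generalized $y$-tower but not $y$-tower. *Bases.* For a monomial order $\prec$, the *degree reducing interpolation monomial basis* (DRIMB) $\mathcal{N}_\prec(\Xi)$ is the Gröbner éscalier: the set of monomials that are not leading monomials of nonzero elements of $\mathcal{I}(\Xi)$. A set $Q$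 of polynomials is a *degree reducing interpolation Newton basis* (DRINB) w.r.t. $\prec$ if $Q=\{p_1,\dots,p_\mu\}$ is a basis of $\mathrm{Span}_{\mathbb{F}}\,\mathcal{N}_\prec(\Xi)$ whose leading monomials satisfy $p_1\prec\dots\prec p_\mu$, and there are a numbering $\xi^{(1)},\dots,\xi^{(\mu)}$ of $\Xi$ and a permutation $\sigma$ of $\{1,\dots,\mu\}$ with $p_{\sigma(j)}(\xi^{(i)})=\delta_{ij}$ for $1\le i\le j\le\mu$. **Theorem.** (1) Let $\Xi=\{u_{ij}=(x_{ij},y_j):(i,j)\in S_x(\Xi)\}$ be a quasi-$x$-tower set, with $x_{ij}$ distinct for fixed $j$. For $(i,j)\in S_x(\Xi)$ let $$\phi^x_{ij}=\varphi^x_{ij}\prod_{t=0}^{j-1}(y-y_t)\prod_{s=0}^{i-1}(x-x_{sj}),\qquad \varphi^x_{ij}=\frac{1}{\prod_{t=0}^{j-1}(y_j-y_t)\prod_{s=0}^{i-1}(x_{ij}-x_{sj})},$$ empty products being $1$. Then, both for $\prec=\prec_{\mathrm{lex}}$ and for $\prec=\prec_{\mathrm{grlex}}$, $\{x^iy^j:(i,j)\in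 S_x(\Xi)\}$ is the DRIMB $\mathcal{N}_\prec(\Xi)$ and $\{\phi^x_{ij}:(i,j)\in S_x(\Xi)\}$ is a DRINB w.r.t. $\prec$. Moreover $\phi^x_{ij}(u_{ab})=\delta_{(i,j),(a,b)}$ for all $(i,j),(a,b)\in S_x(\Xi)$ with $b<j$, or $b=j$ and $a\le i$. (2) Let $\Xi=\{u_{ij}=(x_i,y_{ij}):(i,j)\in S_y(\Xi)\}$ be a quasi-$y$-tower set, with $y_{ij}$ distinct for fixed $i$. For $(i,j)\in S_y(\Xi)$ let $$\phi^y_{ij}=\varphi^y_{ij}\prod_{s=0}^{i-1}(x-x_s)\prod_{t=0}^{j-1}(y-y_{it}),\qquad \varphi^y_{ij}=\frac{1}{\prod_{s=0}^{i-1}(x_i-x_s)\prod_{t=0}^{j-1}(y_{ij}-y_{it})}.$$ Then, both for $\prec=\prec_{\mathrm{invlex}}$ and for $\prec=\prec_{\mathrm{grevlex}}$, $\{x^iy^j:(i,j)\in S_y(\Xi)\}$ is the DRIMB $\mathcal{N}_\prec(\Xi)$ and $\{\phi^y_{ij}:(i,j)\in S_y(\Xi)\}$ is a DRINB w.r.t.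 $\prec$. Moreover $\phi^y_{ij}(u_{ab})=\delta_{(i,j),(a,b)}$ for all $(i,j),(a,b)\in S_y(\Xi)$ with $a<i$, or $a=i$ and $b\le j$. -/

import Mathlib

open MvPolynomial

namespace QuasiTower

/-! ### Monomial orders on `𝔽[x, y]`, with `x = X 0` and `y = X 1`

`lex` and `grlex` (both with `y ≺ x`) are Mathlib's `MonomialOrder.lex` and `MonomialOrder.degLex`
on `Fin 2`. -/

/-- Inverse lexicographic order: `α ≺ β` iff the rightmost nonzero entry of `β - α` is positive. -/
noncomputable def invlex : MonomialOrder (Fin 2) where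
  syn := Colex (Fin 2 →₀ ℕ)
  isOrderedAddMonoid_syn :=
    { add_le_add_left := fun _ _ h c => by simpa using h }
  toSyn :=
    { toEquiv := toColex
      map_add' := fun _ _ => rfl }
  toSyn_monotone := Finsupp.toColex_monotone
  wellFoundedLT_syn := by
    constructor
    exact Finsupp.Lex.wellFounded' (r := fun i j : Fin 2 => j < i)
      (s := fun a b : ℕ => a < b) (fun ⦃_⦄ => Nat.not_lt_zero _) wellFounded_lt wellFounded_lt

/-- A copy of `ℕ²`, to be ordered by the graded reverse lexicographic order. -/
def GrevLex : Type := Fin 2 →₀ ℕ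

noncomputable instance : AddCommMonoid GrevLex :=
  inferInstanceAs (AddCommMonoid (Fin 2 →₀ ℕ))

/-- The identity map from `ℕ²` to its copy. -/
noncomputable def toGrevLex : (Fin 2 →₀ ℕ) ≃+ GrevLex := AddEquiv.refl (Fin 2 →₀ ℕ)

/-- The key `(|α|, α)`, where `α` is compared by the dual of the inverse lexicographic order. -/
noncomputable def grevKey (α : GrevLex) : ℕ ×ₗ (Colex (Fin 2 →₀ ℕ))ᵒᵈ :=
  toLex ((toGrevLex.symm α).degree, OrderDual.toDual (toColex (toGrevLex.symm α)))

theorem grevKey_injective : Function.Injective grevKey := by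
  intro a b h
  exact congrArg (fun z => (ofLex z).2) h

noncomputable instance : LinearOrder GrevLex := LinearOrder.lift' grevKey grevKey_injective

theorem grevLex_le_iff (a b : Fin 2 →₀ ℕ) :
    toGrevLex a ≤ toGrevLex b ↔
      a.degree < b.degree ∨ (a.degree = b.degree ∧ toColex b ≤ toColex a) := by
  change grevKey (toGrevLex a) ≤ grevKey (toGrevLex b) ↔ _
  simp only [grevKey, Prod.Lex.toLex_le_toLex, AddEquiv.symm_apply_apply,
    OrderDual.toDual_le_toDual]

theorem grevLex_lt_iff (a b : Fin 2 →₀ ℕ) :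
    toGrevLex a < toGrevLex b ↔
      a.degree < b.degree ∨ (a.degree = b.degree ∧ toColex b < toColex a) := by
  change grevKey (toGrevLex a) < grevKey (toGrevLex b) ↔ _
  simp only [grevKey, Prod.Lex.toLex_lt_toLex, AddEquiv.symm_apply_apply,
    OrderDual.toDual_lt_toDual]

/-- Graded reverse lexicographic order with `y ≺ x`: `α ≺ β` iff `|α| < |β|`, or `|α| = |β|` and
the rightmost nonzero entry of `β - α` is negative. -/
noncomputable def grevlex : MonomialOrder (Fin 2) where
  syn := GrevLex
  isOrderedAddMonoid_syn :=
    { add_le_add_left := by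
        intro a b h c
        obtain ⟨a, rfl⟩ := toGrevLex.surjective a
        obtain ⟨b, rfl⟩ := toGrevLex.surjective b
        obtain ⟨c, rfl⟩ := toGrevLex.surjective c
        rw [← map_add, ← map_add, grevLex_le_iff]
        rw [grevLex_le_iff] at h
        simpa [toColex_add] using h }
  toSyn := toGrevLex
  toSyn_monotone := by
    intro a b h
    rw [grevLex_le_iff]
    rcases (Finsupp.degree_mono h).lt_or_eq with h1 | h1
    · exact Or.inl h1
    · refine Or.inr ⟨h1, ?_⟩
      obtain ⟨c, rfl⟩ := exists_add_of_le h
      have hc : c.degree = 0 := by rw [map_add] at h1; omega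
      rw [(Finsupp.degree_eq_zero_iff c).1 hc, add_zero]
  wellFoundedLT_syn := by
    constructor
    rw [WellFounded.wellFounded_iff_has_min]
    rintro s ⟨b, hb⟩
    have hfin : (Set.Iic b).Finite := by
      refine ((Finsupp.finite_of_degree_le (σ := Fin 2) (toGrevLex.symm b).degree).image toGrevLex).subset ?_
      intro a ha
      refine ⟨toGrevLex.symm a, ?_, by simp⟩
      have h := (grevLex_le_iff (toGrevLex.symm a) (toGrevLex.symm b)).1 (by simpa using ha)
      rcases h with h | h
      · exact h.le
      · exact h.1.le
    obtain ⟨c, hc⟩ := (hfin.inter_of_right s).exists_minimal ⟨b, hb, le_refl b⟩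
    refine ⟨c, hc.1.1, fun x hx hxc => ?_⟩
    exact hxc.not_ge (hc.2 ⟨hx, hxc.le.trans hc.1.2⟩ hxc.le)

section OrderFacts

open Finsupp
open scoped MonomialOrder

theorem invlex_lt_iff (a b : Fin 2 →₀ ℕ) :
    a ≺[invlex] b ↔ a 1 < b 1 ∨ (a 1 = b 1 ∧ a 0 < b 0) := by
  have : a ≺[invlex] b ↔ toColex a < toColex b := Iff.rfl
  rw [this, Colex.lt_iff]
  change (∃ i : Fin 2, (∀ j, i < j → a j = b j) ∧ a i < b i) ↔ _
  simp [Fin.exists_fin_two, Fin.forall_fin_two]; tauto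

theorem grevlex_lt_iff (a b : Fin 2 →₀ ℕ) :
    a ≺[grevlex] b ↔ a 0 + a 1 < b 0 + b 1 ∨ (a 0 + a 1 = b 0 + b 1 ∧ b 1 < a 1) := by
  have : a ≺[grevlex] b ↔ toGrevLex a < toGrevLex b := Iff.rfl
  rw [this, grevLex_lt_iff, Colex.lt_iff]
  change _ ∨ (_ ∧ (∃ i : Fin 2, (∀ j, i < j → b j = a j) ∧ b i < a i)) ↔ _
  simp [Fin.exists_fin_two, Fin.forall_fin_two, degree_eq_sum]; omega

end OrderFacts

/-! ### The lower sets `S_x(Ξ)` and `S_y(Ξ)` -/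

/-- `L_x(m_0, …, m_ν) = {(i, j) : 0 ≤ j ≤ ν, 0 ≤ i ≤ m_j}`. -/
def Lx {ν : ℕ} (m : Fin (ν + 1) → ℕ) : Finset (ℕ × ℕ) :=
  Finset.univ.biUnion fun j => (Finset.range (m j + 1)).image fun i => (i, (j : ℕ))

/-- `L_y(n_0, …, n_lam) = {(i, j) : 0 ≤ i ≤ lam, 0 ≤ j ≤ n_i}`. -/
def Ly {lam : ℕ} (n : Fin (lam + 1) → ℕ) : Finset (ℕ × ℕ) :=
  Finset.univ.biUnion fun i => (Finset.range (n i + 1)).image fun j => ((i : ℕ), j)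

variable {F : Type*} [DecidableEq F]

/-- The numbers of points of `Ξ` on the horizontal lines that meet `Ξ`, in decreasing order. -/
def rowSizes (Ξ : Finset (F × F)) : List ℕ :=
  ((Ξ.image Prod.snd).val.map fun b => (Ξ.filter fun u => u.2 = b).card).sort (· ≥ ·)

/-- The numbers of points of `Ξ` on the vertical lines that meet `Ξ`, in decreasing order. -/
def colSizes (Ξ : Finset (F × F)) : List ℕ :=
  ((Ξ.image Prod.fst).val.map fun a => (Ξ.filter fun u => u.1 = a).card).sort (· ≥ ·)

/-- `S_x(Ξ)`: the pairs `(i, j)` such that the `j`-th largest row (counted from `0`) has more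
than `i` points. -/
def Sx (Ξ : Finset (F × F)) : Finset (ℕ × ℕ) :=
  (Finset.range (rowSizes Ξ).length).biUnion fun j =>
    (Finset.range ((rowSizes Ξ).getD j 0)).image fun i => (i, j)

/-- `S_y(Ξ)`: the pairs `(i, j)` such that the `i`-th largest column (counted from `0`) has more
than `j` points. -/
def Sy (Ξ : Finset (F × F)) : Finset (ℕ × ℕ) :=
  (Finset.range (colSizes Ξ).length).biUnion fun i =>
    (Finset.range ((colSizes Ξ).getD i 0)).image fun j => (i, j)

/-! ### Tower and quasi-tower sets -/

/-- `Ξ = {(x_{ij}, y_j) : (i, j) ∈ S_x(Ξ)}`, with the `x_{ij}` distinct for fixed `j`. -/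
def IsXLabelling (Ξ : Finset (F × F)) (x : ℕ → ℕ → F) (y : ℕ → F) : Prop :=
  Ξ = (Sx Ξ).image (fun p => (x p.1 p.2, y p.2)) ∧
    ∀ i i' j, (i, j) ∈ Sx Ξ → (i', j) ∈ Sx Ξ → x i j = x i' j → i = i'

/-- `Ξ = {(x_i, y_{ij}) : (i, j) ∈ S_y(Ξ)}`, with the `y_{ij}` distinct for fixed `i`. -/
def IsYLabelling (Ξ : Finset (F × F)) (x : ℕ → F) (y : ℕ → ℕ → F) : Prop :=
  Ξ = (Sy Ξ).image (fun p => (x p.1, y p.1 p.2)) ∧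
    ∀ i j j', (i, j) ∈ Sy Ξ → (i, j') ∈ Sy Ξ → y i j = y i j' → j = j'

/-- Generalized `x`-tower sets. -/
def IsGenXTower (Ξ : Finset (F × F)) : Prop :=
  (∃ (ν : ℕ) (m : Fin (ν + 1) → ℕ), StrictAnti m ∧ Sx Ξ = Lx m) ∧
    ∃ x y, IsXLabelling Ξ x y

/-- `x`-tower sets: in addition every `x_{ij}` lies in `H_0(Ξ)`, the set of abscissae of the
points of `Ξ` on the largest row, which has the ordinate `y_0`. -/
def IsXTower (Ξ : Finset (F × F)) : Prop :=
  (∃ (ν : ℕ) (m : Fin (ν + 1) → ℕ), StrictAnti m ∧ Sx Ξ = Lx m) ∧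
    ∃ x y, IsXLabelling Ξ x y ∧ ∀ i j, (i, j) ∈ Sx Ξ → (x i j, y 0) ∈ Ξ

/-- Quasi-`x`-tower sets. -/
def IsQuasiXTower (Ξ : Finset (F × F)) : Prop := IsGenXTower Ξ ∧ ¬ IsXTower Ξ

/-- Generalized `y`-tower sets. -/
def IsGenYTower (Ξ : Finset (F × F)) : Prop :=
  (∃ (lam : ℕ) (n : Fin (lam + 1) → ℕ), StrictAnti n ∧ Sy Ξ = Ly n) ∧
    ∃ x y, IsYLabelling Ξ x y

/-- `y`-tower sets: in addition every `y_{ij}` lies in `V_0(Ξ)`, the set of ordinates of the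
points of `Ξ` on the largest column, which has the abscissa `x_0`. -/
def IsYTower (Ξ : Finset (F × F)) : Prop :=
  (∃ (lam : ℕ) (n : Fin (lam + 1) → ℕ), StrictAnti n ∧ Sy Ξ = Ly n) ∧
    ∃ x y, IsYLabelling Ξ x y ∧ ∀ i j, (i, j) ∈ Sy Ξ → (x 0, y i j) ∈ Ξ

/-- Quasi-`y`-tower sets. -/
def IsQuasiYTower (Ξ : Finset (F × F)) : Prop := IsGenYTower Ξ ∧ ¬ IsYTower Ξ

end QuasiTower

namespace QuasiTower

open scoped MonomialOrder

variable {F : Type*} [Field F]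

/-! ### Interpolation bases -/

/-- The value of a bivariate polynomial at a point of `𝔽²`. -/
noncomputable def evalAt (u : F × F) (p : MvPolynomial (Fin 2) F) : F := eval ![u.1, u.2] p

/-- The vanishing ideal `I(Ξ)`. -/
noncomputable def idealOf (Ξ : Finset (F × F)) : Ideal (MvPolynomial (Fin 2) F) :=
  vanishingIdeal F ((fun u : F × F => ![u.1, u.2]) '' (Ξ : Set (F × F)))

/-- The Gröbner éscalier of `I(Ξ)`: the monomials that are not the leading monomial of any nonzero
element of `I(Ξ)`. It is the degree reducing interpolation monomial basis (DRIMB) for `Ξ`. -/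
def drimb (ord : MonomialOrder (Fin 2)) (Ξ : Finset (F × F)) : Set (MvPolynomial (Fin 2) F) :=
  {t | ∃ α : Fin 2 →₀ ℕ, t = monomial α 1 ∧ ∀ f ∈ idealOf Ξ, f ≠ 0 → ord.degree f ≠ α}

/-- `Q` is a degree reducing interpolation Newton basis (DRINB) for `Ξ`: it is a basis
`p_1 ≺ ⋯ ≺ p_μ` (ordered by leading monomials) of the degree reducing interpolation space, the
span of the DRIMB, where `μ = #Ξ`, and there are a numbering `ξ` of the points of `Ξ` and a
renumbering `σ` of the basis with `p_{σ(j)}(ξ_i) = δ_{ij}` for `i ≤ j`. -/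
def IsDRINB (ord : MonomialOrder (Fin 2)) (Ξ : Finset (F × F))
    (Q : Set (MvPolynomial (Fin 2) F)) : Prop :=
  ∃ p : Fin Ξ.card → MvPolynomial (Fin 2) F,
    Set.range p = Q ∧
    LinearIndependent F p ∧
    Submodule.span F (Set.range p) = Submodule.span F (drimb ord Ξ) ∧
    (∀ i j, i < j → ord.degree (p i) ≺[ord] ord.degree (p j)) ∧
    ∃ (σ : Equiv.Perm (Fin Ξ.card)) (ξ : Fin Ξ.card ≃ Ξ),
      ∀ i j, i ≤ j → evalAt (ξ i : F × F) (p (σ j)) = if i = j then 1 else 0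

/-- `φ^x_{ij} = c ∏_{t<j} (y - y_t) ∏_{s<i} (x - x_{sj})`,
`1/c = ∏_{t<j} (y_j - y_t) ∏_{s<i} (x_{ij} - x_{sj})`. -/
noncomputable def newtonX (x : ℕ → ℕ → F) (y : ℕ → F) (i j : ℕ) : MvPolynomial (Fin 2) F :=
  C (1 / ((∏ t ∈ Finset.range j, (y j - y t)) * ∏ s ∈ Finset.range i, (x i j - x s j))) *
    (∏ t ∈ Finset.range j, (X 1 - C (y t))) * ∏ s ∈ Finset.range i, (X 0 - C (x s j))

/-- `φ^y_{ij} = c ∏_{s<i} (x - x_s) ∏_{t<j} (y - y_{it})`,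
`1/c = ∏_{s<i} (x_i - x_s) ∏_{t<j} (y_{ij} - y_{it})`. -/
noncomputable def newtonY (x : ℕ → F) (y : ℕ → ℕ → F) (i j : ℕ) : MvPolynomial (Fin 2) F :=
  C (1 / ((∏ s ∈ Finset.range i, (x i - x s)) * ∏ t ∈ Finset.range j, (y i j - y i t))) *
    (∏ s ∈ Finset.range i, (X 0 - C (x s))) * ∏ t ∈ Finset.range j, (X 1 - C (y i t))

end QuasiTower

open QuasiTower

open QuasiTower

/-! Both statements are one statement about points on parallel lines `X l = y t`, with `k` the other
coordinate. Strict decrease of the row lengths gives `(s, t + 1) ∈ S → (s + 1, t) ∈ S`, so if `(a,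
b) ∈ S` then line `t ≤ b` carries at least `a + b - t + 1` points. Of the order only one property is
used: `α ≼ β` implies `α k ≤ β k + β l`.

Suppose `f ≠ 0` vanishes on `Ξ` and has leading monomial `X_k^a X_l^b` with `(a, b) ∈ S`. Its degree
in `X_k` is at most `a + b`, while line `0` holds `a + b + 1` zeros, so `X_l - y_0` divides `f`. The
quotient has leading exponent `(a, b - 1)` and vanishes at the points of the remaining lines, so the
argument repeats. At `b = 0` a factor `X_l - c` would divide a polynomial whose leading monomial is
free of `X_l`, a contradiction (`degree_ne_of_forall_eval_eq_zero`).

Thus the monomials of `S` lie in the éscalier. No others do: one more monomial gives `#Ξ + 1`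
unknown coefficients against `#Ξ` conditions (`mem_of_forall_degree_ne`). The Newton polynomials
have the monomials of `S` as leading monomials and are supported in `S`, so they form a basis by
dimension. Their triangularity is read off from the factors. -/

namespace QuasiTower

open scoped MonomialOrder

/-! ### Leading monomials of interpolating polynomials -/

section General

variable {F : Type*} [Field F]

/-- A polynomial vanishing after the substitution `X l ↦ c` is divisible by `X l - c`. -/
theorem X_sub_C_dvd_of_aeval_update_eq_zero {σ : Type*} [DecidableEq σ] (l : σ) (c : F)
    (f : MvPolynomial σ F) (h : aeval (Function.update X l (C c)) f = 0) :
    (X l - C c : MvPolynomial σ F) ∣ f := by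
  rw [← Ideal.mem_span_singleton, ← Ideal.Quotient.eq_zero_iff_mem]
  let I : Ideal (MvPolynomial σ F) := Ideal.span {X l - C c}
  -- Modulo `X l - c` the substitution is the identity, so `f` is congruent to its substituted value
  -- `0`.
  have key : (Ideal.Quotient.mkₐ F I).comp (aeval (Function.update X l (C c))) =
      Ideal.Quotient.mkₐ F I := by
    ext i
    by_cases hi : i = l
    · subst hi
      simp only [AlgHom.comp_apply, aeval_X, Function.update_self, Ideal.Quotient.mkₐ_eq_mk]
      rw [Ideal.Quotient.eq, ← neg_mem_iff, neg_sub]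
      exact Ideal.mem_span_singleton_self _
    · simp [Function.update_of_ne hi]
  have := congrArg (fun g => g f) key
  rw [AlgHom.comp_apply, h, map_zero] at this
  simpa [I] using this.symm

/-- A polynomial of degree at most `n` in `X k` that vanishes at `n + 1` points of a line
`X l = c` vanishes on that line. -/
theorem X_sub_C_dvd_of_eval_eq_zero {k l : Fin 2} (hkl : k ≠ l) {n : ℕ} {c : F} {x : ℕ → F}
    {f : MvPolynomial (Fin 2) F} (hf : ∀ α ∈ f.support, α k ≤ n)
    (hx : Set.InjOn x (Finset.range (n + 1)))
    (h : ∀ v : Fin 2 → F, v l = c → (∃ s ≤ n, v k = x s) → eval v f = 0) :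
    (X l - C c : MvPolynomial (Fin 2) F) ∣ f := by
  classical
  have hl : ∀ i : Fin 2, i ≠ l → i = k := by omega
  -- Restriction to the line, as a univariate polynomial: its degree is at most `n` and it has `n +
  -- 1` distinct roots.
  let θ : MvPolynomial (Fin 2) F →ₐ[F] Polynomial F :=
    aeval (Function.update (fun _ => Polynomial.X) l (Polynomial.C c))
  have hθ : θ f = 0 := by
    refine Polynomial.eq_zero_of_natDegree_lt_card_of_eval_eq_zero' _
      ((Finset.range (n + 1)).image x) ?_ ?_
    · intro r hr
      obtain ⟨s, hs, rfl⟩ := Finset.mem_image.1 hr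
      have e : (Polynomial.aeval (x s)).comp θ =
          aeval (Function.update (fun _ => x s) l c) := by
        ext i
        by_cases hi : i = l
        · subst hi; simp [θ]
        · simp [θ, Function.update_of_ne hi]
      have e' := congrArg (fun g => g f) e
      simp only [AlgHom.comp_apply, Polynomial.coe_aeval_eq_eval] at e'
      rw [e', MvPolynomial.aeval_eq_eval]
      refine h _ (by simp) ⟨s, by simpa [Nat.lt_succ_iff] using hs, ?_⟩
      simp [Function.update_of_ne hkl]
    · rw [Finset.card_image_of_injOn hx, Finset.card_range, Nat.lt_succ_iff]
      rw [f.as_sum, map_sum]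
      refine Polynomial.natDegree_sum_le_of_forall_le _ _ fun α hα => ?_
      simp only [θ, aeval_monomial]
      rw [Finsupp.prod_fintype _ _ (by simp)]
      refine (Polynomial.natDegree_C_mul_le _ _).trans ?_
      refine (Polynomial.natDegree_prod_le _ _).trans ?_
      refine le_trans (b := ∑ i, if i = k then α k else 0) ?_ (by simpa using hf α hα)
      refine Finset.sum_le_sum fun i _ => ?_
      by_cases hi : i = l
      · subst hi
        simp [Polynomial.natDegree_pow]
      · obtain rfl := hl i hi
        simp [Function.update_of_ne hi]
  apply X_sub_C_dvd_of_aeval_update_eq_zero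
  have e : (Polynomial.aeval (X k : MvPolynomial (Fin 2) F)).comp θ =
      aeval (Function.update X l (C c)) := by
    ext1 i
    by_cases hi : i = l
    · subst hi; simp [θ]
    · obtain rfl := hl i hi
      simp [θ, Function.update_of_ne hi]
  rw [← e, AlgHom.comp_apply, hθ, map_zero]

/-- If `a + b - t + 1` points on the line `X l = y t` are zeros of `f ≠ 0` for all `t ≤ b`, then
`X k ^ a * X l ^ b` is not the leading monomial of `f`. -/
theorem degree_ne_of_forall_eval_eq_zero {ord : MonomialOrder (Fin 2)} {k l : Fin 2} (hkl : k ≠ l)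
    (hord : ∀ α β : Fin 2 →₀ ℕ, α ≼[ord] β → α k ≤ β k + β l) (a b : ℕ) :
    ∀ (x : ℕ → ℕ → F) (y : ℕ → F) (f : MvPolynomial (Fin 2) F), f ≠ 0 →
      Set.InjOn y (Finset.range (b + 1)) →
      (∀ t ≤ b, Set.InjOn (x · t) (Finset.range (a + b - t + 1))) →
      (∀ v : Fin 2 → F, ∀ t ≤ b, v l = y t → (∃ s ≤ a + b - t, v k = x s t) → eval v f = 0) →
      ord.degree f ≠ Finsupp.single k a + Finsupp.single l b := by
  induction b with
  | zero =>
    intro x y f hf _ hx h hdeg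
    have hdvd : (X l - C (y 0) : MvPolynomial (Fin 2) F) ∣ f := by
      refine X_sub_C_dvd_of_eval_eq_zero hkl (n := a) (x := (x · 0)) (fun α hα => ?_)
        (by simpa using hx 0 le_rfl) (fun v hv hs => h v 0 le_rfl hv (by simpa using hs))
      simpa [hdeg, hkl, hkl.symm] using hord _ _ (ord.le_degree hα)
    obtain ⟨g, rfl⟩ := hdvd
    rw [ord.degree_mul' hf, ord.degree_X_sub_C] at hdeg
    -- The factor forces a positive exponent of `X l`, whereas the assumed leading monomial has
    -- exponent `0` there.
    have := congrArg (fun α => α l) hdeg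
    simp [hkl.symm] at this
  | succ b ih =>
    intro x y f hf hy hx h hdeg
    have hdvd : (X l - C (y 0) : MvPolynomial (Fin 2) F) ∣ f := by
      refine X_sub_C_dvd_of_eval_eq_zero hkl (n := a + (b + 1)) (x := (x · 0)) (fun α hα => ?_)
        (by simpa using hx 0 (Nat.zero_le _))
        (fun v hv hs => h v 0 (Nat.zero_le _) hv (by simpa using hs))
      simpa [hdeg, hkl, hkl.symm] using hord _ _ (ord.le_degree hα)
    obtain ⟨g, rfl⟩ := hdvd
    have hg : g ≠ 0 := right_ne_zero_of_mul hf
    rw [ord.degree_mul' hf, ord.degree_X_sub_C] at hdeg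
    -- Line `t` for `g` is line `t + 1` for `f`, and `a + (b + 1) - (t + 1) = a + b - t` keeps the
    -- count of zeros exact. Zeros pass to `g` because `X l - y 0` does not vanish on the other
    -- lines.
    refine ih (fun s t => x s (t + 1)) (fun t => y (t + 1)) g hg ?_ ?_ ?_ ?_
    · intro t ht t' ht' e
      simp only [Finset.coe_range, Set.mem_Iio] at ht ht'
      have := hy (by simpa using ht) (by simpa using ht') e
      omega
    · intro t ht
      have := hx (t + 1) (by omega)
      rwa [show a + (b + 1) - (t + 1) = a + b - t by omega] at this
    · rintro v t ht hv ⟨s, hs, hvs⟩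
      have := h v (t + 1) (by omega) hv ⟨s, by omega, hvs⟩
      rw [map_mul, mul_eq_zero] at this
      refine this.resolve_left fun h0 => ?_
      simp only [map_sub, eval_X, eval_C, hv, sub_eq_zero] at h0
      have := hy (by simp; omega) (by simp) h0
      omega
    · apply add_left_cancel (a := Finsupp.single l 1)
      rw [hdeg, Finsupp.single_add l b 1]
      abel

/-- Polynomials with pairwise distinct leading monomials are linearly independent. -/
theorem linearIndependent_of_degree_injective {σ ι : Type*} (ord : MonomialOrder σ)
    {p : ι → MvPolynomial σ F} (h0 : ∀ i, p i ≠ 0)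
    (hp : Function.Injective fun i => ord.degree (p i)) : LinearIndependent F p := by
  classical
  rw [linearIndependent_iff']
  intro s g hg
  by_contra! hne
  obtain ⟨i₀, hi₀, hgi₀⟩ := hne
  -- The largest leading monomial with a nonzero coefficient occurs in no other term, so it cannot
  -- cancel.
  obtain ⟨i, hi, hmax⟩ := (s.filter (g · ≠ 0)).exists_max_image
    (fun i => ord.toSyn (ord.degree (p i))) ⟨i₀, by simp [hi₀, hgi₀]⟩
  rw [Finset.mem_filter] at hi
  have hc := congrArg (coeff (ord.degree (p i))) hg
  rw [coeff_sum, Finset.sum_eq_single i] at hc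
  · simp only [coeff_smul, smul_eq_mul, coeff_zero, mul_eq_zero] at hc
    exact hc.elim hi.2 (ord.coeff_degree_ne_zero_iff.2 (h0 i))
  · intro j hj hji
    by_cases hgj : g j = 0
    · simp [hgj]
    · rw [coeff_smul, ord.coeff_eq_zero_of_lt, smul_zero]
      refine lt_of_le_of_ne (hmax j (by simp [hj, hgj])) fun e => hji (hp ?_)
      exact ord.toSyn.injective e
  · exact fun h => absurd hi.1 h

/-- A finite set can be enumerated in increasing order of an injective key. -/
theorem exists_equiv_fin_strictMono {α β : Type*} [LinearOrder β] (S : Finset α) {f : α → β}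
    (hf : Function.Injective f) {n : ℕ} (hn : S.card = n) :
    ∃ g : Fin n ≃ S, ∀ i j, i < j → f (g i) < f (g j) := by
  let e := (S.map ⟨f, hf⟩).orderIsoOfFin (k := n) (by simpa using hn)
  let r : S ≃ (S.map ⟨f, hf⟩ : Finset β) := Equiv.ofBijective
    (fun a => ⟨f a, Finset.mem_map_of_mem ⟨f, hf⟩ a.2⟩) <| by
      constructor
      · intro a b h
        exact Subtype.ext (hf (congrArg Subtype.val h))
      · rintro ⟨b, hb⟩
        obtain ⟨a, ha, rfl⟩ := Finset.mem_map.1 hb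
        exact ⟨⟨a, ha⟩, rfl⟩
  have hr : ∀ i, f (r.symm (e i)) = e i := fun i =>
    congrArg Subtype.val (r.apply_symm_apply (e i))
  refine ⟨e.toEquiv.trans r.symm, fun i j hij => ?_⟩
  simp only [Equiv.trans_apply, RelIso.coe_fn_toEquiv, hr]
  exact e.strictMono hij

end General

/-! ### Newton polynomials along parallel lines -/

section Newton

variable {F : Type*}

/-- `c ∏_{τ<t} (X_l - y_τ) ∏_{σ<s} (X_k - x_{σt})`,
`1/c = ∏_{τ<t} (y_t - y_τ) ∏_{σ<s} (x_{st} - x_{σt})`. -/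
noncomputable def newton [Field F] (k l : Fin 2) (x : ℕ → ℕ → F) (y : ℕ → F) (q : ℕ × ℕ) :
    MvPolynomial (Fin 2) F :=
  C (1 / ((∏ t ∈ Finset.range q.2, (y q.2 - y t)) *
      ∏ s ∈ Finset.range q.1, (x q.1 q.2 - x s q.2))) *
    (∏ t ∈ Finset.range q.2, (X l - C (y t))) * ∏ s ∈ Finset.range q.1, (X k - C (x s q.2))

/-- The exponent of `X_k ^ s * X_l ^ t`. -/
noncomputable def expo (k l : Fin 2) (q : ℕ × ℕ) : Fin 2 →₀ ℕ :=
  Finsupp.single k q.1 + Finsupp.single l q.2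

theorem expo_injective {k l : Fin 2} (hkl : k ≠ l) : Function.Injective (expo k l) := by
  intro p q h
  have h1 := congrArg (fun α => α k) h
  have h2 := congrArg (fun α => α l) h
  simp [expo, hkl, hkl.symm] at h1 h2
  exact Prod.ext h1 h2

theorem expo_apply {k l : Fin 2} (hkl : k ≠ l) (α : Fin 2 →₀ ℕ) : expo k l (α k, α l) = α := by
  ext i
  obtain rfl | rfl : i = k ∨ i = l := by omega
  · simp [expo, hkl.symm]
  · simp [expo, hkl]

/-- Counting linear factors suffices. Consequently every monomial in the support divides `X_k^s
X_l^t`, which keeps the polynomial in the span of a lower set. -/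
theorem degreeOf_newton_le [Field F] (k l : Fin 2) (x : ℕ → ℕ → F) (y : ℕ → F) (q : ℕ × ℕ)
    (i : Fin 2) : degreeOf i (newton k l x y q) ≤ expo k l q i := by
  have hX : ∀ (j : Fin 2) (c : F), degreeOf i (X j - C c : MvPolynomial (Fin 2) F) ≤
      if i = j then 1 else 0 := by
    intro j c
    refine (degreeOf_sub_le _ _ _).trans ?_
    simp [degreeOf_X]
  rw [newton, mul_assoc]
  refine (degreeOf_C_mul_le _ _ _).trans ((degreeOf_mul_le _ _ _).trans ?_)
  rw [expo, Finsupp.add_apply, add_comm]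
  refine add_le_add ?_ ?_
  · refine (degreeOf_prod_le _ _ _).trans ((Finset.sum_le_sum fun s _ => hX k _).trans ?_)
    by_cases h : i = k <;> simp [h]
  · refine (degreeOf_prod_le _ _ _).trans ((Finset.sum_le_sum fun s _ => hX l _).trans ?_)
    by_cases h : i = l <;> simp [h]

/-- `Ξ` is labelled along the lines `X_l = y_t` by the lower set `S`, whose rows are strictly
decreasing. -/
structure TowerData (k l : Fin 2) (Ξ : Finset (F × F)) (S : Finset (ℕ × ℕ)) (u : ℕ × ℕ → F × F)
    (x : ℕ → ℕ → F) (y : ℕ → F) : Prop where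
  ne : k ≠ l
  mem_pred : ∀ s t, (s + 1, t) ∈ S → (s, t) ∈ S
  mem_shift : ∀ s t, (s, t + 1) ∈ S → (s + 1, t) ∈ S
  coord_k : ∀ s t, ![(u (s, t)).1, (u (s, t)).2] k = x s t
  coord_l : ∀ s t, ![(u (s, t)).1, (u (s, t)).2] l = y t
  mem_iff : ∀ v, v ∈ Ξ ↔ ∃ q ∈ S, u q = v
  inj_x : ∀ s s' t, (s, t) ∈ S → (s', t) ∈ S → x s t = x s' t → s = s'
  inj_y : ∀ t t', (0, t) ∈ S → (0, t') ∈ S → y t = y t' → t = t'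

namespace TowerData

variable {k l : Fin 2} {Ξ : Finset (F × F)} {S : Finset (ℕ × ℕ)} {u : ℕ × ℕ → F × F}
  {x : ℕ → ℕ → F} {y : ℕ → F} (h : TowerData k l Ξ S u x y)

include h

theorem mem_of_le {s s' t : ℕ} (hs : s ≤ s') (hq : (s', t) ∈ S) : (s, t) ∈ S := by
  induction s', hs using Nat.le_induction with
  | base => exact hq
  | succ n _ ih => exact ih (h.mem_pred _ _ hq)

theorem mem_of_add {s t d : ℕ} (hq : (s, t + d) ∈ S) : (s + d, t) ∈ S := by
  induction d generalizing s with
  | zero => exact hq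
  | succ d ih =>
    have := ih (h.mem_shift s (t + d) hq)
    rwa [show s + 1 + d = s + (d + 1) by omega] at this

/-- These are exactly the zeros that `degree_ne_of_forall_eval_eq_zero` consumes: each line down
gains at least one point. -/
theorem mem_of_add_le {s t a b : ℕ} (hq : (a, b) ∈ S) (ht : t ≤ b) (hs : s ≤ a + b - t) :
    (s, t) ∈ S := by
  obtain ⟨d, rfl⟩ := Nat.exists_eq_add_of_le ht
  exact h.mem_of_le (by omega) (h.mem_of_add hq)

theorem u_injOn : Set.InjOn u S := by
  rintro ⟨s, t⟩ hq ⟨s', t'⟩ hq' e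
  have ht : t = t' := by
    refine h.inj_y t t' (h.mem_of_le (Nat.zero_le _) hq) (h.mem_of_le (Nat.zero_le _) hq') ?_
    rw [← h.coord_l s, ← h.coord_l s', e]
  subst ht
  have hs : s = s' := by
    refine h.inj_x s s' t hq hq' ?_
    rw [← h.coord_k, ← h.coord_k, e]
  rw [hs]

theorem card_eq [DecidableEq F] : S.card = Ξ.card := by
  rw [show Ξ = S.image u by ext v; simp [h.mem_iff], Finset.card_image_of_injOn h.u_injOn]

variable [Field F]

theorem factor_y_ne_zero {s t τ : ℕ} (hq : (s, t) ∈ S) (hτ : τ < t) : y t - y τ ≠ 0 := by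
  intro e
  have := h.inj_y t τ (h.mem_of_le (Nat.zero_le _) hq)
    (h.mem_of_add_le hq hτ.le (Nat.zero_le _)) (sub_eq_zero.1 e)
  omega

theorem factor_x_ne_zero {s t σ : ℕ} (hq : (s, t) ∈ S) (hσ : σ < s) : x s t - x σ t ≠ 0 := by
  intro e
  have := h.inj_x s σ t hq (h.mem_of_le hσ.le hq) (sub_eq_zero.1 e)
  omega

theorem denom_ne_zero {q : ℕ × ℕ} (hq : q ∈ S) :
    (∏ t ∈ Finset.range q.2, (y q.2 - y t)) * ∏ s ∈ Finset.range q.1, (x q.1 q.2 - x s q.2) ≠ 0 :=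
  mul_ne_zero
    (Finset.prod_ne_zero_iff.2 fun _ ht => h.factor_y_ne_zero hq (Finset.mem_range.1 ht))
    (Finset.prod_ne_zero_iff.2 fun _ hs => h.factor_x_ne_zero hq (Finset.mem_range.1 hs))

/-- On an earlier line a factor in `X l` vanishes; earlier on the same line, a factor in `X k` does.
At `q` itself the constant normalizes the product. -/
theorem evalAt_newton {q r : ℕ × ℕ} (hq : q ∈ S) (hr : r.2 < q.2 ∨ (r.2 = q.2 ∧ r.1 ≤ q.1)) :
    evalAt (u r) (newton k l x y q) = if r = q then 1 else 0 := by
  obtain ⟨a, b⟩ := r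
  obtain ⟨s, t⟩ := q
  simp only [evalAt, newton, map_mul, map_prod, map_sub, eval_C, eval_X, h.coord_k, h.coord_l]
  rcases hr with hb | ⟨rfl, ha⟩
  · rw [if_neg (fun e => hb.ne (congrArg Prod.snd e)),
      mul_eq_zero, mul_eq_zero]
    exact Or.inl (Or.inr (Finset.prod_eq_zero (i := b) (by simpa using hb) (sub_self _)))
  · rcases ha.lt_or_eq with ha | rfl
    · rw [if_neg (fun e => ha.ne (congrArg Prod.fst e)), mul_eq_zero]
      right
      exact Finset.prod_eq_zero (i := a) (by simpa using ha) (by simp)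
    · rw [if_pos rfl, mul_assoc]
      exact one_div_mul_cancel (h.denom_ne_zero hq)

theorem newton_ne_zero {q : ℕ × ℕ} (hq : q ∈ S) : newton k l x y q ≠ 0 := by
  intro e
  have := h.evalAt_newton hq (r := q) (by simp)
  simp [e, evalAt] at this

/-- Every monomial order gives `X i - c` the leading monomial `X i`, and degrees add in products
over a field. -/
theorem degree_newton (ord : MonomialOrder (Fin 2)) {q : ℕ × ℕ} (hq : q ∈ S) :
    ord.degree (newton k l x y q) = expo k l q := by
  have hX : ∀ (i : Fin 2) (c : F), (X i - C c : MvPolynomial (Fin 2) F) ≠ 0 := fun i c =>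
    (ord.monic_X_sub_C i c).ne_zero
  have h0 := h.newton_ne_zero hq
  rw [newton] at h0 ⊢
  rw [ord.degree_mul' h0, ord.degree_mul' (left_ne_zero_of_mul h0), ord.degree_C,
    ord.degree_prod fun _ _ => hX _ _, ord.degree_prod fun _ _ => hX _ _]
  simp [ord.degree_X_sub_C, expo, add_comm]

theorem mem_idealOf_iff {f : MvPolynomial (Fin 2) F} :
    f ∈ idealOf Ξ ↔ ∀ q ∈ S, evalAt (u q) f = 0 := by
  simp only [idealOf, mem_vanishingIdeal_iff, Set.forall_mem_image, SetLike.mem_coe, h.mem_iff,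
    evalAt, MvPolynomial.aeval_eq_eval]
  exact ⟨fun H q hq => H ⟨q, hq, rfl⟩, by rintro H _ ⟨q, hq, rfl⟩; exact H q hq⟩

/-! ### Éscalier and Newton basis for orders bounding the exponent of `X k` -/

section Order

variable {ord : MonomialOrder (Fin 2)} (hord : ∀ α β : Fin 2 →₀ ℕ, α ≼[ord] β → α k ≤ β k + β l)

include hord

theorem degree_ne_expo {q : ℕ × ℕ} (hq : q ∈ S) {f : MvPolynomial (Fin 2) F}
    (hf : f ∈ idealOf Ξ) (h0 : f ≠ 0) : ord.degree f ≠ expo k l q := by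
  obtain ⟨a, b⟩ := q
  refine degree_ne_of_forall_eval_eq_zero h.ne hord a b x y f h0 ?_ ?_ ?_
  · intro t ht t' ht' e
    simp only [Finset.coe_range, Set.mem_Iio, Nat.lt_succ_iff] at ht ht'
    exact h.inj_y _ _ (h.mem_of_add_le hq ht (Nat.zero_le _))
      (h.mem_of_add_le hq ht' (Nat.zero_le _)) e
  · intro t ht s hs s' hs' e
    simp only [Finset.coe_range, Set.mem_Iio, Nat.lt_succ_iff] at hs hs'
    exact h.inj_x _ _ _ (h.mem_of_add_le hq ht hs) (h.mem_of_add_le hq ht hs') e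
  · rintro v t ht hv ⟨s, hs, hvs⟩
    have hv' : v = ![(u (s, t)).1, (u (s, t)).2] := by
      ext i
      obtain rfl | rfl : i = k ∨ i = l := by have := h.ne; omega
      · rw [hvs, h.coord_k]
      · rw [hv, h.coord_l]
    rw [hv']
    exact h.mem_idealOf_iff.1 hf _ (h.mem_of_add_le hq ht hs)

/-- If `α` were outside `S`, some nonzero combination of `α` and the monomials of `S` would vanish
on `Ξ`. Its leading monomial would be `α` or belong to `S`, and both are excluded. -/
theorem mem_of_forall_degree_ne {α : Fin 2 →₀ ℕ}
    (hα : ∀ f ∈ idealOf Ξ, f ≠ 0 → ord.degree f ≠ α) : ∃ q ∈ S, expo k l q = α := by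
  classical
  by_contra! hne
  let T : Finset (Fin 2 →₀ ℕ) := insert α (S.image (expo k l))
  have hT : T.card = S.card + 1 := by
    rw [Finset.card_insert_of_notMem (by simpa using hne),
      Finset.card_image_of_injective _ (expo_injective h.ne)]
  -- Coefficients are sent to values at the points; the kernel is nontrivial since `T` has one
  -- element more than `S`.
  let Φ : (T → F) →ₗ[F] (S → F) := LinearMap.pi fun q =>
    ∑ β : T, (evalAt (u q) (monomial (β : Fin 2 →₀ ℕ) (1 : F))) • LinearMap.proj β
  obtain ⟨c, hc, hc0⟩ := (Submodule.ne_bot_iff _).1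
    (LinearMap.ker_ne_bot_of_finrank_lt (f := Φ) (by simp [hT]))
  let f : MvPolynomial (Fin 2) F := ∑ β : T, c β • monomial (β : Fin 2 →₀ ℕ) (1 : F)
  have hcoeff : ∀ β : T, coeff (β : Fin 2 →₀ ℕ) f = c β := by
    intro β
    simp only [f, coeff_sum, coeff_smul, coeff_monomial, smul_eq_mul]
    rw [Finset.sum_eq_single β]
    · simp
    · intro γ _ hγ
      rw [if_neg (fun e => hγ (Subtype.ext e)), mul_zero]
    · simp
  have hf0 : f ≠ 0 := by
    intro e
    exact hc0 (funext fun β => by rw [← hcoeff β, e]; simp)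
  have hfI : f ∈ idealOf Ξ := by
    rw [h.mem_idealOf_iff]
    intro q hq
    have := congrFun (LinearMap.mem_ker.1 hc) ⟨q, hq⟩
    simp only [Φ, LinearMap.pi_apply, LinearMap.sum_apply, LinearMap.smul_apply,
      LinearMap.proj_apply, Pi.zero_apply, smul_eq_mul] at this
    rw [← this]
    simp only [f, evalAt, map_sum, smul_eval]
    exact Finset.sum_congr rfl fun _ _ => mul_comm _ _
  have hdeg : ord.degree f ∈ T := by
    by_contra hd
    refine ord.coeff_degree_ne_zero_iff.2 hf0 ?_
    simp only [f, coeff_sum, coeff_smul, coeff_monomial, smul_eq_mul]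
    refine Finset.sum_eq_zero fun β _ => ?_
    rw [if_neg, mul_zero]
    rintro e
    exact hd (by rw [← show (β : Fin 2 →₀ ℕ) = ord.degree f from e]; exact β.2)
  rcases Finset.mem_insert.1 hdeg with e | e
  · exact hα f hfI hf0 e
  · obtain ⟨q, hq, e⟩ := Finset.mem_image.1 e
    exact h.degree_ne_expo hord hq hfI hf0 e.symm

theorem drimb_eq : drimb ord Ξ = (fun q => monomial (expo k l q) (1 : F)) '' S := by
  ext f
  constructor
  · rintro ⟨α, rfl, hα⟩
    obtain ⟨q, hq, rfl⟩ := h.mem_of_forall_degree_ne hord hα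
    exact ⟨q, hq, rfl⟩
  · rintro ⟨q, hq, rfl⟩
    exact ⟨_, rfl, fun f hf h0 => h.degree_ne_expo hord hq hf h0⟩

theorem newton_mem_span {q : ℕ × ℕ} (hq : q ∈ S) :
    newton k l x y q ∈ Submodule.span F (drimb ord Ξ) := by
  rw [h.drimb_eq hord, (newton k l x y q).as_sum]
  refine Submodule.sum_mem _ fun α hα => ?_
  rw [show monomial α (coeff α (newton k l x y q)) =
    coeff α (newton k l x y q) • monomial α (1 : F) by simp [smul_monomial]]
  refine Submodule.smul_mem _ _ (Submodule.subset_span ⟨(α k, α l), ?_, by simp [expo_apply h.ne]⟩)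
  have hle : ∀ i, α i ≤ expo k l q i := fun i =>
    degreeOf_le_iff.1 (degreeOf_newton_le k l x y q i) α hα
  have h1 := hle k
  have h2 := hle l
  simp only [expo, Finsupp.add_apply, Finsupp.single_eq_same, Finsupp.single_eq_of_ne h.ne,
    Finsupp.single_eq_of_ne h.ne.symm, zero_add, add_zero] at h1 h2
  exact h.mem_of_add_le (a := q.1) (b := q.2) hq h2 (by omega)

theorem isDRINB : IsDRINB ord Ξ (newton k l x y '' S) := by
  classical
  -- Evaluation is triangular in the line-by-line order of `(t, s)`, which need not be the order of
  -- leading monomials. So `g` enumerates by monomials, `e` by lines, and `σ` is `e` followed by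
  -- `g.symm`.
  have hkey : Function.Injective fun q : ℕ × ℕ => toLex (q.2, q.1) := by
    rintro ⟨a, b⟩ ⟨c, d⟩ e
    have := toLex.injective e
    simp only [Prod.mk.injEq] at this
    exact Prod.ext this.2 this.1
  obtain ⟨g, hg⟩ := exists_equiv_fin_strictMono S
    (ord.toSyn.injective.comp (expo_injective h.ne)) h.card_eq
  obtain ⟨e, he⟩ := exists_equiv_fin_strictMono S hkey h.card_eq
  let U : S ≃ Ξ := Equiv.ofBijective (fun q => ⟨u q, (h.mem_iff _).2 ⟨q, q.2, rfl⟩⟩) <| by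
    constructor
    · intro q r hqr
      exact Subtype.ext (h.u_injOn q.2 r.2 (congrArg Subtype.val hqr))
    · rintro ⟨v, hv⟩
      obtain ⟨q, hq, rfl⟩ := (h.mem_iff v).1 hv
      exact ⟨⟨q, hq⟩, rfl⟩
  have hdeg : ∀ i, ord.degree (newton k l x y (g i)) = expo k l (g i) := fun i =>
    h.degree_newton ord (g i).2
  have hlin : LinearIndependent F fun i => newton k l x y (g i) := by
    refine linearIndependent_of_degree_injective ord (fun i => h.newton_ne_zero (g i).2) ?_
    intro i j hij
    simp only [hdeg] at hij
    exact g.injective (Subtype.ext (expo_injective h.ne hij))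
  refine ⟨fun i => newton k l x y (g i), ?_, hlin, ?_, ?_, e.trans g.symm, e.trans U, ?_⟩
  · ext f
    constructor
    · rintro ⟨i, rfl⟩
      exact ⟨_, (g i).2, rfl⟩
    · rintro ⟨q, hq, rfl⟩
      exact ⟨g.symm ⟨q, hq⟩, by simp⟩
  · have hfin : (drimb ord Ξ).Finite := by
      rw [h.drimb_eq hord]
      exact S.finite_toSet.image _
    have : FiniteDimensional F (Submodule.span F (drimb ord Ξ)) :=
      FiniteDimensional.span_of_finite F hfin
    refine Submodule.eq_of_le_of_finrank_le (Submodule.span_le.2 ?_) ?_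
    · rintro _ ⟨i, rfl⟩
      exact h.newton_mem_span hord (g i).2
    -- The éscalier spans dimension at most `#S`, already attained by the independent Newton
    -- polynomials.
    · rw [finrank_span_eq_card hlin, Fintype.card_fin, ← h.card_eq, h.drimb_eq hord,
        ← Finset.coe_image]
      exact (finrank_span_finset_le_card _).trans Finset.card_image_le
  · intro i j hij
    rw [hdeg, hdeg]
    exact hg i j hij
  · intro i j hij
    have hval : ((e.trans U) i : F × F) = u (e i) := rfl
    rw [hval]
    simp only [Equiv.trans_apply, Equiv.apply_symm_apply]
    rw [h.evalAt_newton (e j).2]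
    · simp
    · rcases hij.lt_or_eq with hij | rfl
      · have := he i j hij
        rw [Prod.Lex.toLex_lt_toLex] at this
        exact this.imp_right fun w => ⟨w.1, w.2.le⟩
      · simp

end Order

end TowerData

end Newton

/-! ### The two families of tower sets -/

section Towers

variable {F : Type*} [DecidableEq F]

theorem mem_Sx_iff {Ξ : Finset (F × F)} {i j : ℕ} :
    (i, j) ∈ Sx Ξ ↔ j < (rowSizes Ξ).length ∧ i < (rowSizes Ξ).getD j 0 := by
  simp only [Sx, Finset.mem_biUnion, Finset.mem_image, Finset.mem_range, Prod.mk.injEq]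
  grind

theorem mem_Sy_iff {Ξ : Finset (F × F)} {i j : ℕ} :
    (i, j) ∈ Sy Ξ ↔ i < (colSizes Ξ).length ∧ j < (colSizes Ξ).getD i 0 := by
  simp only [Sy, Finset.mem_biUnion, Finset.mem_image, Finset.mem_range, Prod.mk.injEq]
  grind

theorem mem_Lx_iff {ν : ℕ} {m : Fin (ν + 1) → ℕ} {i j : ℕ} :
    (i, j) ∈ Lx m ↔ ∃ h : j < ν + 1, i ≤ m ⟨j, h⟩ := by
  simp only [Lx, Finset.mem_biUnion, Finset.mem_image, Finset.mem_range, Prod.mk.injEq,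
    Finset.mem_univ, true_and]
  constructor
  · rintro ⟨j, i, hi, rfl, rfl⟩
    exact ⟨j.2, by simpa [Nat.lt_succ_iff] using hi⟩
  · rintro ⟨h, hi⟩
    exact ⟨⟨j, h⟩, i, by omega, rfl, rfl⟩

theorem mem_Ly_iff {lam : ℕ} {n : Fin (lam + 1) → ℕ} {i j : ℕ} :
    (i, j) ∈ Ly n ↔ ∃ h : i < lam + 1, j ≤ n ⟨i, h⟩ := by
  simp only [Ly, Finset.mem_biUnion, Finset.mem_image, Finset.mem_range, Prod.mk.injEq,
    Finset.mem_univ, true_and]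
  constructor
  · rintro ⟨i, j, hj, rfl, rfl⟩
    exact ⟨i.2, by simpa [Nat.lt_succ_iff] using hj⟩
  · rintro ⟨h, hj⟩
    exact ⟨⟨i, h⟩, j, by omega, rfl, rfl⟩

theorem mem_Lx_shift {ν : ℕ} {m : Fin (ν + 1) → ℕ} (hm : StrictAnti m) {i j : ℕ}
    (h : (i, j + 1) ∈ Lx m) : (i + 1, j) ∈ Lx m := by
  rw [mem_Lx_iff] at h ⊢
  obtain ⟨hj, hi⟩ := h
  exact ⟨by omega, hi.trans_lt (hm (show (⟨j, by omega⟩ : Fin (ν + 1)) < ⟨j + 1, hj⟩ by simp))⟩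

theorem mem_Ly_shift {lam : ℕ} {n : Fin (lam + 1) → ℕ} (hn : StrictAnti n) {i j : ℕ}
    (h : (i + 1, j) ∈ Ly n) : (i, j + 1) ∈ Ly n := by
  rw [mem_Ly_iff] at h ⊢
  obtain ⟨hi, hj⟩ := h
  exact ⟨by omega, hj.trans_lt (hn (show (⟨i, by omega⟩ : Fin (lam + 1)) < ⟨i + 1, hi⟩ by simp))⟩

/-- Labels of lines are distinct if they lie in `{0, …, N - 1}`, where `N` is the number of
lines. -/
theorem injOn_of_card_image {ι : Type*} {Ξ : Finset (F × F)} {S : Finset ι} {pr : F × F → F}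
    {v : ι → F × F} {t : ι → ℕ} {y : ℕ → F} (hΞ : Ξ = S.image v) (hv : ∀ q, pr (v q) = y (t q))
    (ht : ∀ q ∈ S, t q < (Ξ.image pr).card) : Set.InjOn y (S.image t) := by
  refine Finset.injOn_of_card_image_eq (le_antisymm Finset.card_image_le ?_)
  have h1 : (S.image t).image y = Ξ.image pr := by
    rw [hΞ, Finset.image_image, Finset.image_image]
    exact Finset.image_congr fun q _ => (hv q).symm
  rw [h1]
  -- The labels lie in `{0, …, N - 1}` and `y` maps them onto `N` lines, so none can collide.
  refine (Finset.card_le_card (t := Finset.range (Ξ.image pr).card) ?_).trans_eq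
    (Finset.card_range _)
  intro n hn
  obtain ⟨q, hq, rfl⟩ := Finset.mem_image.1 hn
  exact Finset.mem_range.2 (ht q hq)

/-- A labelling does not assert that the `y_j` are distinct. This follows by counting, as `rowSizes`
has one entry for each horizontal line meeting `Ξ`. -/
theorem towerData_of_isGenXTower {Ξ : Finset (F × F)} {x : ℕ → ℕ → F} {y : ℕ → F}
    (hΞ : IsGenXTower Ξ) (h : IsXLabelling Ξ x y) :
    TowerData 0 1 Ξ (Sx Ξ) (fun q => (x q.1 q.2, y q.2)) x y := by
  obtain ⟨⟨ν, m, hm, hS⟩, -⟩ := hΞ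
  refine ⟨by decide, ?_, ?_, fun _ _ => rfl, fun _ _ => rfl, ?_, h.2, ?_⟩
  · intro s t
    simp only [mem_Sx_iff]
    omega
  · intro s t
    rw [hS]
    exact mem_Lx_shift hm
  · intro v
    nth_rw 1 [h.1]
    exact Finset.mem_image
  · intro t t' ht ht' e
    refine injOn_of_card_image (pr := Prod.snd) (t := Prod.snd) h.1 (fun _ => rfl) ?_
      (Finset.mem_image_of_mem Prod.snd ht) (Finset.mem_image_of_mem Prod.snd ht') e
    rintro ⟨i, j⟩ hq
    simpa [rowSizes, Finset.card_def, Finset.image_val] using (mem_Sx_iff.1 hq).1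

/-- The lines are now vertical, so the coordinates and the index pairs are exchanged. -/
theorem towerData_of_isGenYTower {Ξ : Finset (F × F)} {x : ℕ → F} {y : ℕ → ℕ → F}
    (hΞ : IsGenYTower Ξ) (h : IsYLabelling Ξ x y) :
    TowerData 1 0 Ξ ((Sy Ξ).image Prod.swap) (fun q => (x q.2, y q.2 q.1))
      (fun s t => y t s) x := by
  obtain ⟨⟨lam, n, hn, hS⟩, -⟩ := hΞ
  have hmem : ∀ s t, (s, t) ∈ (Sy Ξ).image Prod.swap ↔ (t, s) ∈ Sy Ξ := by
    intro s t
    simp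
  refine ⟨by decide, ?_, ?_, fun _ _ => rfl, fun _ _ => rfl, ?_, ?_, ?_⟩
  · intro s t
    simp only [hmem, mem_Sy_iff]
    omega
  · intro s t
    rw [hmem, hmem, hS]
    exact mem_Ly_shift hn
  · intro v
    nth_rw 1 [h.1]
    simp only [Finset.mem_image, Prod.exists, Prod.swap_prod_mk, Prod.mk.injEq]
    grind
  · intro s s' t hs hs' e
    rw [hmem] at hs hs'
    exact h.2 _ _ _ hs hs' e
  · intro t t' ht ht' e
    rw [hmem] at ht ht'
    refine injOn_of_card_image (pr := Prod.fst) (t := Prod.fst) h.1 (fun _ => rfl) ?_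
      (Finset.mem_image_of_mem Prod.fst ht) (Finset.mem_image_of_mem Prod.fst ht') e
    rintro ⟨i, j⟩ hq
    simpa [colSizes, Finset.card_def, Finset.image_val] using (mem_Sy_iff.1 hq).1

end Towers

theorem monomial_expo {F : Type*} [Field F] (k l : Fin 2) (q : ℕ × ℕ) :
    (monomial (expo k l q) (1 : F)) = X k ^ q.1 * X l ^ q.2 := by
  rw [expo, X_pow_eq_monomial, X_pow_eq_monomial, monomial_mul, one_mul]

/-! ### Bounds for the exponents of smaller monomials -/

theorem lex_apply_zero_le {α β : Fin 2 →₀ ℕ} (h : α ≼[MonomialOrder.lex] β) : α 0 ≤ β 0 := by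
  by_contra! hlt
  refine (not_lt.2 h) ?_
  rw [MonomialOrder.lex_lt_iff, Finsupp.Lex.lt_iff]
  exact ⟨0, fun j hj => absurd hj (Fin.not_lt_zero j), hlt⟩

theorem degLex_sum_le {α β : Fin 2 →₀ ℕ} (h : α ≼[MonomialOrder.degLex] β) :
    α 0 + α 1 ≤ β 0 + β 1 := by
  have := Finsupp.DegLex.monotone_degree (MonomialOrder.degLex_le_iff.1 h)
  simpa [Finsupp.degree_eq_sum] using this

theorem invlex_apply_one_le {α β : Fin 2 →₀ ℕ} (h : α ≼[invlex] β) : α 1 ≤ β 1 := by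
  by_contra! hlt
  exact (not_lt.2 h) ((invlex_lt_iff β α).2 (Or.inl hlt))

theorem grevlex_sum_le {α β : Fin 2 →₀ ℕ} (h : α ≼[grevlex] β) :
    α 0 + α 1 ≤ β 0 + β 1 := by
  by_contra! hlt
  exact (not_lt.2 h) ((grevlex_lt_iff β α).2 (Or.inl hlt))

end QuasiTower

/-! ### Specialization to the four orders -/

theorem mainTheorem1 {F : Type*} [Field F] [DecidableEq F] :
    (∀ (Ξ : Finset (F × F)) (x : ℕ → ℕ → F) (y : ℕ → F),
      IsQuasiXTower Ξ → IsXLabelling Ξ x y →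
        (∀ ord : MonomialOrder (Fin 2),
          ord = MonomialOrder.lex ∨ ord = MonomialOrder.degLex →
            (fun p : ℕ × ℕ => (X 0 ^ p.1 * X 1 ^ p.2 : MvPolynomial (Fin 2) F)) '' (Sx Ξ)
                = drimb ord Ξ ∧
              IsDRINB ord Ξ ((fun p : ℕ × ℕ => newtonX x y p.1 p.2) '' (Sx Ξ))) ∧
        (∀ i j a b : ℕ, (i, j) ∈ Sx Ξ → (a, b) ∈ Sx Ξ → (b < j ∨ (b = j ∧ a ≤ i)) →
          evalAt (x a b, y b) (newtonX x y i j) = if (a, b) = (i, j) then 1 else 0)) ∧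
    (∀ (Ξ : Finset (F × F)) (x : ℕ → F) (y : ℕ → ℕ → F),
      IsQuasiYTower Ξ → IsYLabelling Ξ x y →
        (∀ ord : MonomialOrder (Fin 2),
          ord = invlex ∨ ord = grevlex →
            (fun p : ℕ × ℕ => (X 0 ^ p.1 * X 1 ^ p.2 : MvPolynomial (Fin 2) F)) '' (Sy Ξ)
                = drimb ord Ξ ∧
              IsDRINB ord Ξ ((fun p : ℕ × ℕ => newtonY x y p.1 p.2) '' (Sy Ξ))) ∧
        (∀ i j a b : ℕ, (i, j) ∈ Sy Ξ → (a, b) ∈ Sy Ξ → (a < i ∨ (a = i ∧ b ≤ j)) →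
          evalAt (x a, y a b) (newtonY x y i j) = if (a, b) = (i, j) then 1 else 0)) := by
  constructor
  · intro Ξ x y hΞ h
    have T := towerData_of_isGenXTower hΞ.1 h
    refine ⟨fun ord hord => ?_, fun i j a b hij _ hlt => T.evalAt_newton (q := (i, j))
      (r := (a, b)) hij hlt⟩
    -- For `lex` the first exponent itself is monotone; for `degLex` it is bounded by the total
    -- degree, which is monotone.
    have hb : ∀ α β : Fin 2 →₀ ℕ, ord.toSyn α ≤ ord.toSyn β → α 0 ≤ β 0 + β 1 := by
      intro α β hαβ
      rcases hord with rfl | rfl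
      · have := lex_apply_zero_le hαβ
        omega
      · have := degLex_sum_le hαβ
        omega
    refine ⟨?_, T.isDRINB hb⟩
    rw [T.drimb_eq hb]
    simp only [monomial_expo]
  · intro Ξ x y hΞ h
    have T := towerData_of_isGenYTower hΞ.1 h
    have himage : ∀ (f : ℕ × ℕ → MvPolynomial (Fin 2) F),
        f '' ((Sy Ξ).image Prod.swap : Finset (ℕ × ℕ)) = (fun p : ℕ × ℕ => f p.swap) '' (Sy Ξ) := by
      intro f
      rw [Finset.coe_image, Set.image_image]
    refine ⟨fun ord hord => ?_, fun i j a b hij _ hlt => ?_⟩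
    · have hb : ∀ α β : Fin 2 →₀ ℕ, ord.toSyn α ≤ ord.toSyn β → α 1 ≤ β 1 + β 0 := by
        intro α β hαβ
        rcases hord with rfl | rfl
        · have := invlex_apply_one_le hαβ
          omega
        · have := grevlex_sum_le hαβ
          omega
      constructor
      · rw [T.drimb_eq hb, himage]
        simp only [monomial_expo, Prod.fst_swap, Prod.snd_swap, mul_comm]
      · have := T.isDRINB hb
        rwa [himage] at this
    · have := T.evalAt_newton (q := (j, i)) (r := (b, a)) (by simpa using hij) hlt
      refine this.trans ?_
      simp only [Prod.mk.injEq, and_comm]
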